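/- Let $K$ be a compact Hausdorff topological group and let $G$ be a (discrete) group. Assume that no subgroup of $G$ is isomorphic to the additive group $\mathbb{Q}$ of rational numbers, to the additive group $\mathbb{Z}_p$ of $p$-adic integers for any prime $p$, or to the Prüfer $p$-group $\mathbb{Z}(p^\infty)$ (the group of elements of $p$-power order in $\mathbb{Q}/\mathbb{Z}$) for any prime $p$. Assume further that every abelian torsion subgroup of $G$ is artinian, where a group $H$ is called artinian if every non-empty collection of subgroups of $H$ has a minimal element with respect to inclusion. Then for every (not necessarily continuous) group homomorphism $\varphi\colon K\to G$ the image $\varphi(K)$ is a torsion group, i.e. all of its elements have finite order. -/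

import Mathlib

/-- The Prüfer `p`-group `ℤ(p^∞)`: the subgroup of `ℚ/ℤ` of all elements whose order is a power
of `p`. -/
abbrev PruferGroup (p : ℕ) [Fact p.Prime] : Type :=
  AddCommGroup.primaryComponent (ℚ ⧸ (Int.castAddHom ℚ).range) p

/-- `G` includes (a copy of) the additive group `A` as a subgroup: some subgroup of the
multiplicatively written group `G` is isomorphic to `A`. -/
def IncludesAddGroup (G : Type*) [Group G] (A : Type*) [AddGroup A] : Prop :=
  ∃ H : Subgroup G, Nonempty (Multiplicative A ≃* H)

/-- A group is artinian if every non-empty collection of its subgroups has a minimal element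
with respect to inclusion. -/
def IsArtinianGroup (H : Type*) [Group H] : Prop :=
  ∀ S : Set (Subgroup H), S.Nonempty → ∃ M, Minimal (· ∈ S) M

/-! Compactness reduces the claim to `K = ∏ ℤ_[p]`: every `g` in `K` is the image of `1` under a
homomorphism from the profinite integers. Its composite with `φ` has abelian image `A`. Artinianity
and the absence of Prüfer subgroups give some `n ≠ 0` killing the torsion of `A`, so the `n`-th
multiple of the map has torsion-free image. That multiple is not injective on any factor `ℤ_[p]`,
and a nonzero kernel there makes the image divisible, hence zero as `ℚ` is excluded. It therefore
kills all finitely supported elements; modulo these the product is divisible, so the whole image is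
divisible and again zero. Thus `φ g ^ n = 1`. -/

/-- In a divisible abelian group every element is the image of `1` under some homomorphism
from `ℚ`. -/
theorem exists_rat_addMonoidHom_map_one {D : Type*} [AddCommGroup D]
    (hD : ∀ n : ℕ, n ≠ 0 → ∀ x : D, ∃ y, n • y = x) (x : D) : ∃ f : ℚ →+ D, f 1 = x := by
  let _ : DivisibleBy D ℕ := divisibleByOfSMulRightSurj D ℕ fun {n} hn x => hD n hn x
  let _ : DivisibleBy D ℤ := AddGroup.divisibleByIntOfDivisibleByNat D
  obtain ⟨f, hf⟩ := (Module.Baer.of_divisible D).extension_property_addMonoidHom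
    (Int.castAddHom ℚ) Int.cast_injective (zmultiplesHom D x)
  refine ⟨f, ?_⟩
  have := DFunLike.congr_fun hf 1
  simpa using this

theorem exists_injective_rat_addMonoidHom {D : Type*} [AddCommGroup D] [Nontrivial D]
    (hD : ∀ n : ℕ, n ≠ 0 → ∀ x : D, ∃ y, n • y = x)
    (htf : ∀ n : ℕ, n ≠ 0 → ∀ x : D, n • x = 0 → x = 0) :
    ∃ f : ℚ →+ D, Function.Injective f := by
  obtain ⟨x, hx⟩ := exists_ne (0 : D)
  obtain ⟨f, hf⟩ := exists_rat_addMonoidHom_map_one hD x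
  refine ⟨f, (injective_iff_map_eq_zero f).2 fun q hq => ?_⟩
  by_contra hne
  apply hx
  refine htf q.num.natAbs (by simpa using hne) x ?_
  have h : q.num • x = 0 := by
    rw [← hf, ← map_zsmul]
    have : q.num • (1 : ℚ) = q.den • q := by
      simp [mul_comm, Rat.mul_den_eq_num]
    rw [this, map_nsmul, hq, smul_zero]
  rwa [← natAbs_nsmul_eq_zero] at h

/-- A map from `ℚ` sending `1 / p` to an element of order `p` kills `ℤ`; the induced map is
injective on `p`-torsion, hence on the whole `p`-primary part. -/
theorem exists_injective_pruferGroup_addMonoidHom {D : Type*} [AddCommGroup D] [Nontrivial D]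
    (hD : ∀ n : ℕ, n ≠ 0 → ∀ x : D, ∃ y, n • y = x) (htors : ∀ x : D, IsOfFinAddOrder x) :
    ∃ (p : ℕ) (_ : Fact p.Prime) (f : PruferGroup p →+ D), Function.Injective f := by
  obtain ⟨z, hz⟩ := exists_ne (0 : D)
  obtain ⟨p, hp, hpz⟩ := Nat.exists_prime_and_dvd (n := addOrderOf z)
    (by rwa [Ne, AddMonoid.addOrderOf_eq_one_iff])
  have : Fact p.Prime := ⟨hp⟩
  obtain ⟨k, hk⟩ := hpz
  have hz0 : addOrderOf z ≠ 0 := (htors z).addOrderOf_pos.ne'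
  set x := k • z with hxdef
  have hx : addOrderOf x = p := by
    rw [hxdef, addOrderOf_nsmul_of_dvd (by rintro rfl; simp_all) (Dvd.intro_left _ hk.symm), hk]
    exact Nat.mul_div_cancel _ (Nat.pos_of_ne_zero (by rintro rfl; simp_all))
  obtain ⟨h, hh⟩ := exists_rat_addMonoidHom_map_one hD x
  have hp0 : (p : ℚ) ≠ 0 := by exact_mod_cast hp.ne_zero
  let f : ℚ →+ D := h.comp (AddMonoidHom.mulLeft (p : ℚ))
  have hfm (m : ℤ) : f ((m : ℚ) / p) = m • x := by
    simp only [f, AddMonoidHom.comp_apply, AddMonoidHom.coe_mulLeft]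
    rw [mul_div_cancel₀ _ hp0, ← hh, ← map_zsmul]
    simp
  have hker : (Int.castAddHom ℚ).range ≤ f.ker := by
    rintro _ ⟨m, rfl⟩
    rw [AddMonoidHom.mem_ker]
    have := hfm (m * p)
    rw [Int.cast_mul, Int.cast_natCast, mul_div_cancel_right₀ _ hp0, mul_smul] at this
    rw [Int.coe_castAddHom, this, natCast_zsmul, ← hx, addOrderOf_nsmul_eq_zero, smul_zero]
  let F := QuotientAddGroup.lift _ f hker
  have key (v : ℚ ⧸ (Int.castAddHom ℚ).range) (hpv : p • v = 0) (hv : F v = 0) : v = 0 := by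
    induction v using QuotientAddGroup.induction_on with
    | H r =>
      rw [← QuotientAddGroup.mk_nsmul, QuotientAddGroup.eq_zero_iff] at hpv
      obtain ⟨m, hm⟩ := hpv
      have hr : r = (m : ℚ) / p := by
        rw [eq_div_iff hp0, mul_comm]
        simpa using hm.symm
      have hfr : f r = 0 := hv
      rw [hr, hfm, ← addOrderOf_dvd_iff_zsmul_eq_zero, hx] at hfr
      obtain ⟨c, rfl⟩ := hfr
      rw [QuotientAddGroup.eq_zero_iff]
      refine ⟨c, ?_⟩
      rw [hr]
      push_cast
      rw [mul_div_cancel_left₀ _ hp0]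
      simp
  refine ⟨p, ‹_›, F.comp (AddSubgroup.subtype _), (injective_iff_map_eq_zero _).2 ?_⟩
  rintro ⟨u, hu⟩ hFu
  obtain ⟨k, hk⟩ := hu
  replace hFu : F u = 0 := hFu
  suffices u = 0 from Subtype.ext this
  clear * - key hk hFu
  induction k with
  | zero => simpa using hk
  | succ k ih =>
    apply ih
    apply key
    · rw [smul_smul, ← pow_succ', hk]
    · rw [map_nsmul, hFu, smul_zero]

/-- A torsion abelian group without Prüfer subgroups whose chain of subgroups `n! • T` stabilizes
has finite exponent. -/
theorem exists_nsmul_eq_zero_of_factorial_chain {T : Type*} [AddCommGroup T]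
    (htors : ∀ x : T, IsOfFinAddOrder x)
    (hP : ∀ (p : ℕ) [Fact p.Prime] (f : PruferGroup p →+ T), ¬ Function.Injective f)
    {n : ℕ} (hn : ∀ m, n ≤ m → ∀ x : T, ∃ y : T, m.factorial • y = n.factorial • x) (x : T) :
    n.factorial • x = 0 := by
  by_contra hx
  let D := (nsmulAddMonoidHom (α := T) n.factorial).range
  have : Nontrivial D := ⟨⟨⟨_, x, rfl⟩, 0, fun h => hx (congrArg Subtype.val h)⟩⟩
  obtain ⟨p, _, f, hf⟩ := exists_injective_pruferGroup_addMonoidHom (D := D) (by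
    rintro m hm ⟨_, t, rfl⟩
    obtain ⟨y, hy⟩ := hn (n + m) (Nat.le_add_right _ _) t
    obtain ⟨c, hc⟩ := Nat.factorial_mul_factorial_dvd_factorial_add n m
    obtain ⟨e, he⟩ := Nat.dvd_factorial (Nat.pos_of_ne_zero hm) le_rfl
    refine ⟨⟨_, (e * c) • y, rfl⟩, Subtype.ext ?_⟩
    simp only [AddSubgroup.coe_nsmul, nsmulAddMonoidHom_apply]
    rw [← hy, hc, he, smul_smul, smul_smul]
    congr 1
    ring) (fun d => AddSubmonoid.isOfFinAddOrder_coe.1 (htors d))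
  exact hP p (D.subtype.comp f) (D.subtype_injective.comp hf)

/-! ### Homomorphisms out of the profinite integers -/

instance Nat.Primes.fact_prime (p : Nat.Primes) : Fact (p : ℕ).Prime := ⟨p.2⟩

/-- The ring of profinite integers, as the product of all rings of `p`-adic integers. -/
abbrev ProfiniteInt : Type := ∀ p : Nat.Primes, ℤ_[p]

/-- The multiples of a unit `u` of `ℤ_[p]` represent all classes modulo `p`. -/
theorem PadicInt.exists_nsmul_add_nsmul {p : ℕ} [Fact p.Prime] {u : ℤ_[p]} (hu : IsUnit u)
    (z : ℤ_[p]) : ∃ (y : ℤ_[p]) (m : ℕ), z = p • y + m • u := by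
  obtain ⟨v, hv⟩ := hu.exists_right_inv
  obtain ⟨y, hy⟩ : (p : ℤ_[p]) ∣ z * v - ((z * v).zmodRepr : ℕ) := by
    rw [← Ideal.mem_span_singleton, ← PadicInt.maximalIdeal_eq_span_p]
    exact PadicInt.sub_zmodRepr_mem _
  refine ⟨y * u, (z * v).zmodRepr, ?_⟩
  rw [nsmul_eq_mul, nsmul_eq_mul]
  linear_combination u * hy - z * hv

theorem PadicInt.exists_nsmul_eq_of_not_dvd {p : ℕ} [Fact p.Prime] {n : ℕ} (hn : ¬ p ∣ n)
    (z : ℤ_[p]) : ∃ y : ℤ_[p], n • y = z := by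
  have hu : IsUnit (n : ℤ_[p]) := by
    rw [PadicInt.isUnit_iff]
    by_contra h
    exact hn (PadicInt.norm_natCast_lt_one_iff.1 (lt_of_le_of_ne (PadicInt.norm_le_one _) h))
  obtain ⟨v, hv⟩ := hu.exists_right_inv
  exact ⟨v * z, by rw [nsmul_eq_mul, ← mul_assoc, hv, one_mul]⟩

/-- A homomorphism with torsion-free and divisible image vanishes if its target does not
contain `ℚ`. -/
theorem AddMonoidHom.eq_zero_of_divisible_range {A B : Type*} [AddCommGroup A] [AddCommGroup B]
    (ψ : A →+ B) (htf : ∀ n : ℕ, n ≠ 0 → ∀ x, n • ψ x = 0 → ψ x = 0)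
    (hdiv : ∀ n : ℕ, n ≠ 0 → ∀ x, ∃ y, n • ψ y = ψ x)
    (hQ : ∀ f : ℚ →+ B, ¬ Function.Injective f) : ψ = 0 := by
  by_contra hne
  obtain ⟨x, hx⟩ := DFunLike.ne_iff.1 hne
  have : Nontrivial ψ.range := ⟨⟨⟨_, x, rfl⟩, 0, fun h => hx (congrArg Subtype.val h)⟩⟩
  obtain ⟨f, hf⟩ := exists_injective_rat_addMonoidHom (D := ψ.range)
    (by
      rintro n hn ⟨_, x, rfl⟩
      obtain ⟨y, hy⟩ := hdiv n hn x
      exact ⟨⟨_, y, rfl⟩, Subtype.ext hy⟩)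
    (by
      rintro n hn ⟨_, x, rfl⟩ h
      exact Subtype.ext (htf n hn x (congrArg Subtype.val h)))
  exact hQ (ψ.range.subtype.comp f) (ψ.range.subtype_injective.comp hf)

/-- A non-injective homomorphism from `ℤ_[p]` with torsion-free image vanishes if its target does
not contain `ℚ`: its kernel is pure and contains a unit, so its image is divisible. -/
theorem PadicInt.addMonoidHom_eq_zero {p : ℕ} [Fact p.Prime] {B : Type*} [AddCommGroup B]
    (ψ : ℤ_[p] →+ B) (htf : ∀ n : ℕ, n ≠ 0 → ∀ x, n • ψ x = 0 → ψ x = 0)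
    (hQ : ∀ f : ℚ →+ B, ¬ Function.Injective f) (hψ : ¬ Function.Injective ψ) : ψ = 0 := by
  obtain ⟨x, hx, hx0⟩ : ∃ x, ψ x = 0 ∧ x ≠ 0 := by
    simpa [injective_iff_map_eq_zero] using hψ
  obtain ⟨u, hu, hu0⟩ : ∃ u : ℤ_[p], IsUnit u ∧ ψ u = 0 := by
    refine ⟨PadicInt.unitCoeff hx0, Units.isUnit _, ?_⟩
    refine htf (p ^ x.valuation) (pow_ne_zero _ (Fact.out : p.Prime).ne_zero) _ ?_
    rw [← map_nsmul, ← hx, nsmul_eq_mul]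
    congr 1
    conv_rhs => rw [PadicInt.unitCoeff_spec hx0]
    push_cast
    ring
  have hpdiv (k : ℕ) : ∀ z, ∃ y, p ^ k • ψ y = ψ z := by
    induction k with
    | zero => exact fun z => ⟨z, by simp⟩
    | succ k ih =>
      intro z
      obtain ⟨y, m, rfl⟩ := PadicInt.exists_nsmul_add_nsmul hu z
      obtain ⟨w, hw⟩ := ih y
      exact ⟨w, by
        rw [pow_succ', mul_smul, hw, map_add, map_nsmul, map_nsmul, hu0, smul_zero, add_zero]⟩
  refine ψ.eq_zero_of_divisible_range htf (fun n hn z => ?_) hQ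
  obtain ⟨k, m, hm, rfl⟩ := Nat.exists_eq_pow_mul_and_not_dvd hn p (Fact.out : p.Prime).ne_one
  obtain ⟨y, hy⟩ := hpdiv k z
  obtain ⟨w, hw⟩ := PadicInt.exists_nsmul_eq_of_not_dvd hm y
  exact ⟨w, by rw [← hy, ← hw, map_nsmul, smul_smul]⟩

/-- A homomorphism from the profinite integers with torsion-free image vanishes if its target
contains neither `ℚ` nor any `ℤ_[p]`. -/
theorem addMonoidHom_profiniteInt_eq_zero {B : Type*} [AddCommGroup B]
    (ψ : ProfiniteInt →+ B)
    (htf : ∀ n : ℕ, n ≠ 0 → ∀ x, n • ψ x = 0 → ψ x = 0)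
    (hQ : ∀ f : ℚ →+ B, ¬ Function.Injective f)
    (hZp : ∀ (p : ℕ) [Fact p.Prime] (f : ℤ_[p] →+ B), ¬ Function.Injective f) : ψ = 0 := by
  classical
  have hsingle (p : Nat.Primes) (z : ℤ_[p]) : ψ (Pi.single p z) = 0 := by
    have := PadicInt.addMonoidHom_eq_zero
      (ψ.comp (AddMonoidHom.single (fun p : Nat.Primes => ℤ_[p]) p))
      (fun n hn x => htf n hn _) hQ (hZp p _)
    exact DFunLike.congr_fun this z
  refine ψ.eq_zero_of_divisible_range htf (fun n hn x => ?_) hQ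
  have hfin : {p : Nat.Primes | (p : ℕ) ∣ n}.Finite :=
    Set.Finite.of_finite_image ((Set.finite_le_nat n).subset (by
      rintro _ ⟨p, hp, rfl⟩
      exact Nat.le_of_dvd (Nat.pos_of_ne_zero hn) hp)) (Subtype.val_injective.injOn)
  have hy (p : Nat.Primes) : ∃ y : ℤ_[p], ¬ (p : ℕ) ∣ n → n • y = x p := by
    by_cases hp : (p : ℕ) ∣ n
    · exact ⟨0, fun h => absurd hp h⟩
    · obtain ⟨y, hy⟩ := PadicInt.exists_nsmul_eq_of_not_dvd hp (x p)
      exact ⟨y, fun _ => hy⟩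
  choose y hy using hy
  -- The remainder `x - n • y` lives on the finitely many primes dividing `n`, so `ψ` kills it.
  have hx : x = n • y + ∑ p ∈ hfin.toFinset, Pi.single p ((x - n • y) p) := by
    ext p : 1
    rw [Pi.add_apply, Finset.sum_apply, Finset.sum_pi_single]
    by_cases hp : (p : ℕ) ∣ n
    · simp [hp]
    · simp [hp, ← hy p hp]
  refine ⟨y, ?_⟩
  conv_rhs => rw [hx]
  rw [map_add, map_nsmul, map_sum, Finset.sum_eq_zero fun p _ => hsingle p _, add_zero]

/-! ### Mapping the profinite integers to a compact group -/

/-- `1` is a direct summand of every finitely generated subgroup of the profinite integers that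
contains it. -/
theorem exists_linearMap_apply_eq_one {M : Submodule ℤ ProfiniteInt} (hM : M.FG)
    (h1 : 1 ∈ M) : ∃ r : M →ₗ[ℤ] ℤ, r ⟨1, h1⟩ = 1 := by
  have : Module.Finite ℤ M := Module.Finite.iff_fg.2 hM
  -- The ideal of values of functionals at `1`. A prime dividing its generator would divide `1` in
  -- `M`, hence in some `ℤ_[q]`.
  let ev := LinearMap.range (Module.Dual.eval ℤ M ⟨1, h1⟩)
  obtain ⟨d, hd⟩ := (inferInstance : ev.IsPrincipal)
  suffices IsUnit d by
    have h : (1 : ℤ) ∈ ev := by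
      rw [hd]
      exact Ideal.mem_span_singleton.2 this.dvd
    exact h
  let b := Module.Free.chooseBasis ℤ M
  have hdvd i : d ∣ b.repr ⟨1, h1⟩ i := by
    have : b.coord i ⟨1, h1⟩ ∈ ev := ⟨b.coord i, rfl⟩
    rw [hd] at this
    exact Ideal.mem_span_singleton.1 this
  choose c hc using hdvd
  have hsum : (⟨1, h1⟩ : M) = d • ∑ i, c i • b i := by
    rw [Finset.smul_sum, ← b.sum_repr ⟨1, h1⟩]
    exact Finset.sum_congr rfl fun i _ => by rw [hc, mul_smul]
  by_contra hdu
  obtain ⟨p, hp, hpd⟩ := Int.exists_prime_and_dvd (n := d) (by rwa [Ne, ← Int.isUnit_iff_natAbs_eq])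
  obtain ⟨q, hqp⟩ : ∃ q : Nat.Primes, (q : ℕ) = p.natAbs :=
    ⟨⟨p.natAbs, Int.prime_iff_natAbs_prime.1 hp⟩, rfl⟩
  have hq : ((q : ℕ) : ℤ_[q]) ∣ 1 := by
    have h1q := congrFun (congrArg Subtype.val hsum) q
    have hdq : ((q : ℕ) : ℤ) ∣ d := by rw [hqp]; exact Int.natAbs_dvd.2 hpd
    have hcast := (Int.castRingHom ℤ_[q]).map_dvd hdq
    refine (by simpa using hcast : ((q : ℕ) : ℤ_[q]) ∣ d).trans ⟨(∑ i, c i • b i : M).1 q, ?_⟩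
    rw [← zsmul_eq_mul]
    exact h1q
  exact PadicInt.p_nonunit (isUnit_of_dvd_one hq)

/-- Every element of a compact Hausdorff group is the image of `1` under a homomorphism from the
profinite integers, a limit of partial homomorphisms defined on finitely generated subgroups. -/
theorem exists_profiniteInt_monoidHom_of_compact {K : Type*} [Group K] [TopologicalSpace K]
    [IsTopologicalGroup K] [CompactSpace K] [T2Space K] (g : K) :
    ∃ Φ : Multiplicative ProfiniteInt →* K, Φ (Multiplicative.ofAdd 1) = g := by
  classical
  have hr (s : Finset ProfiniteInt) : ∃ r : Submodule.span ℤ (insert 1 s : Set ProfiniteInt) →ₗ[ℤ] ℤ,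
      r ⟨1, Submodule.subset_span (Set.mem_insert _ _)⟩ = 1 :=
    exists_linearMap_apply_eq_one (Submodule.fg_span (s.finite_toSet.insert _)) _
  choose r hr using hr
  -- The value `1` off the span is harmless: each `x` eventually lies in `s` along `U`.
  let F (s : Finset ProfiniteInt) (x : ProfiniteInt) : K :=
    if hx : x ∈ Submodule.span ℤ (insert 1 s : Set ProfiniteInt) then g ^ r s ⟨x, hx⟩ else 1
  let U : Ultrafilter (Finset ProfiniteInt) := Ultrafilter.of Filter.atTop
  have hlim (x : ProfiniteInt) : ∃ k : K, Filter.Tendsto (F · x) U (nhds k) := by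
    obtain ⟨k, -, hk⟩ := isCompact_univ.ultrafilter_le_nhds (U.map (F · x)) (by simp)
    exact ⟨k, hk⟩
  choose Φ hΦ using hlim
  have hmem (x : ProfiniteInt) : ∀ᶠ s : Finset ProfiniteInt in U, x ∈ s :=
    Ultrafilter.of_le _ ((Filter.eventually_ge_atTop {x}).mono fun s hs => by simpa using hs)
  have hadd (x y : ProfiniteInt) : Φ (x + y) = Φ x * Φ y := by
    refine tendsto_nhds_unique (hΦ (x + y)) (((hΦ x).mul (hΦ y)).congr' ?_)
    filter_upwards [hmem x, hmem y] with s hx hy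
    have hx' : x ∈ Submodule.span ℤ (insert 1 s : Set ProfiniteInt) := Submodule.subset_span (.inr hx)
    have hy' : y ∈ Submodule.span ℤ (insert 1 s : Set ProfiniteInt) := Submodule.subset_span (.inr hy)
    simp only [F, dif_pos hx', dif_pos hy', dif_pos (add_mem hx' hy')]
    rw [← zpow_add, ← map_add]
    rfl
  refine ⟨MonoidHom.mk' (fun x => Φ x.toAdd) fun x y => hadd _ _, ?_⟩
  refine tendsto_nhds_unique (hΦ 1) (tendsto_const_nhds.congr fun s => ?_)
  have h1 : (1 : ProfiniteInt) ∈ Submodule.span ℤ (insert 1 s : Set ProfiniteInt) :=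
    Submodule.subset_span (Set.mem_insert _ _)
  simp only [F, dif_pos h1]
  rw [hr, zpow_one]

theorem IncludesAddGroup.of_injective {G A : Type*} [Group G] [AddGroup A]
    (f : Multiplicative A →* G) (hf : Function.Injective f) : IncludesAddGroup G A :=
  ⟨f.range, ⟨MonoidHom.ofInjective hf⟩⟩

theorem IncludesAddGroup.of_injective_additive {G A : Type*} [Group G] [AddGroup A]
    {H : Subgroup G} (f : A →+ Additive H) (hf : Function.Injective f) : IncludesAddGroup G A :=
  .of_injective (H.subtype.comp (AddMonoidHom.toMultiplicativeLeft f))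
    (H.subtype_injective.comp hf)

open IsMulCommutative in
/-- The elements of finite order in an abelian subgroup have bounded order. -/
theorem exists_pow_eq_one_of_isOfFinOrder {G : Type*} [Group G]
    (hPrufer : ∀ (p : ℕ) [Fact p.Prime], ¬ IncludesAddGroup G (PruferGroup p))
    (hArt : ∀ H : Subgroup G, IsMulCommutative H → IsMulTorsion H → IsArtinianGroup H)
    (H : Subgroup G) [IsMulCommutative H] :
    ∃ n : ℕ, n ≠ 0 ∧ ∀ h : H, IsOfFinOrder h → h ^ n = 1 := by
  let T : Subgroup G := (CommGroup.torsion H).map H.subtype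
  have hT : IsMulTorsion T := by
    rintro ⟨_, h, hh, rfl⟩
    exact Submonoid.isOfFinOrder_coe.1 (H.subtype.isOfFinOrder hh)
  obtain ⟨_, ⟨n, rfl⟩, hmin⟩ := hArt T inferInstance hT
    -- Factorials make these power subgroups a descending chain, so a minimal one is where it
    -- stabilizes.
    (Set.range fun n : ℕ => (powMonoidHom n.factorial : T →* T).range) (Set.range_nonempty _)
  refine ⟨n.factorial, n.factorial_ne_zero, fun h hh => ?_⟩
  have := exists_nsmul_eq_zero_of_factorial_chain (T := Additive T) (n := n)
    (fun x => (isOfFinAddOrder_ofMul_iff (x := x.toMul)).2 (hT x.toMul))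
    (fun p _ f hf => hPrufer p (.of_injective_additive f hf))
    (fun m hm x => by
      have hle : (powMonoidHom m.factorial : T →* T).range ≤
          (powMonoidHom n.factorial : T →* T).range := by
        rintro _ ⟨t, rfl⟩
        obtain ⟨c, hc⟩ := Nat.factorial_dvd_factorial hm
        exact ⟨t ^ c, by simp only [powMonoidHom_apply]; rw [← pow_mul, hc, mul_comm]⟩
      exact hmin ⟨m, rfl⟩ hle ⟨x.toMul, rfl⟩)
    (Additive.ofMul ⟨h, h, hh, rfl⟩)
  exact Subtype.ext (congrArg (fun t : Additive T => (t.toMul : G)) this)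

open IsMulCommutative in
/-- Under the hypotheses of the main theorem, every homomorphism from the profinite integers sends
`1` to an element of finite order. -/
theorem isOfFinOrder_map_ofAdd_one_of_profiniteInt {G : Type*} [Group G]
    (hQ : ¬ IncludesAddGroup G ℚ)
    (hZp : ∀ (p : ℕ) [Fact p.Prime], ¬ IncludesAddGroup G ℤ_[p])
    (hPrufer : ∀ (p : ℕ) [Fact p.Prime], ¬ IncludesAddGroup G (PruferGroup p))
    (hArt : ∀ H : Subgroup G, IsMulCommutative H → IsMulTorsion H → IsArtinianGroup H)
    (χ : Multiplicative ProfiniteInt →* G) : IsOfFinOrder (χ (Multiplicative.ofAdd 1)) := by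
  obtain ⟨n, hn, hbound⟩ := exists_pow_eq_one_of_isOfFinOrder hPrufer hArt χ.range
  let θ : ProfiniteInt →+ Additive χ.range := MonoidHom.toAdditiveRight χ.rangeRestrict
  have hψ : n • θ = 0 := by
    refine addMonoidHom_profiniteInt_eq_zero (n • θ) (fun m hm x h => ?_)
      (fun f hf => hQ (.of_injective_additive f hf))
      (fun p _ f hf => hZp p (.of_injective_additive f hf))
    -- If `m` kills `n • θ x`, then `θ x` is itself torsion, so `n` already kills it.
    refine hbound (θ x).toMul (isOfFinOrder_iff_pow_eq_one.2 ⟨m * n, by positivity, ?_⟩)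
    rw [AddMonoidHom.nsmul_apply, smul_smul] at h
    exact h
  refine isOfFinOrder_iff_pow_eq_one.2 ⟨n, by positivity, ?_⟩
  exact congrArg (fun t : Additive χ.range => (t.toMul : G)) (DFunLike.congr_fun hψ 1)

theorem mainTheorem7 {K : Type*} [Group K] [TopologicalSpace K] [IsTopologicalGroup K]
    [CompactSpace K] [T2Space K] {G : Type*} [Group G]
    (hQ : ¬ IncludesAddGroup G ℚ)
    (hZp : ∀ (p : ℕ) [Fact p.Prime], ¬ IncludesAddGroup G ℤ_[p])
    (hPrufer : ∀ (p : ℕ) [Fact p.Prime], ¬ IncludesAddGroup G (PruferGroup p))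
    (hArt : ∀ H : Subgroup G, IsMulCommutative H → IsMulTorsion H → IsArtinianGroup H)
    (φ : K →* G) : IsMulTorsion φ.range := by
  rintro ⟨_, g, rfl⟩
  rw [← Submonoid.isOfFinOrder_coe]
  obtain ⟨Φ, rfl⟩ := exists_profiniteInt_monoidHom_of_compact g
  exact isOfFinOrder_map_ofAdd_one_of_profiniteInt hQ hZp hPrufer hArt (φ.comp Φ)
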